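/- A quantale is a complete lattice $A$ (with bottom $0$ and top $1$) with an associative multiplication that distributes over arbitrary joins in each variable. Let $A$ be a quantale that is commutative and integral ($1$ is the unit of the multiplication). Let $K(A)$ be the set of compact elements of $A$, and suppose that $A$ is coherent: every element of $A$ is a join of compact elements, $1\in K(A)$, and $K(A)$ is closed under multiplication. For $c\in A$ put $c^{\perp}=\bigvee\{x\in A\mid cx=0\}$. An element $a\in A$ is pure if $a\vee c^{\perp}=1$ for every $c\in K(A)$ with $c\le a$, and $A$ is a $PF$-quantale if $c^{\perp}$ is pure for every $c\in K(A)$. Let $Spec(A)$ be the set of $m$-prime elements, i.e. of all $p<1$ in $A$ such that $xy\le p$ implies $x\le p$ or $y\le p$ for all $x,y\in A$, and let $Min(A)$ be the set of minimal elements of $Spec(A)$. Let $Spec_Z(A)$ be $Spec(A)$ with the topology whose closed sets are the sets $V(x)=\{p\in Spec(A)\mid x\le p\}$, $x\in A$, and let $Spec_F(A)$ be $Spec(A)$ with the flat topology, which has as a basis of open sets the complements of the compact open subsets of $Spec_Z(A)$. **Theorem 6.10.** Let $A$ be a coherent $PF$-quantale. An element $a\in A$ is pure if and only if $a=\bigwedge(Min(A)\cap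 E)$ for some closed subset $E$ of $Spec_F(A)$ (where $\bigwedge\emptyset=1$). -/

import Mathlib

open scoped Topology

namespace Quantale

/-- A (unital) quantale is integral if the unit of the multiplication is the top element. -/
class IsIntegral (A : Type*) [CommMonoid A] [CompleteLattice A] : Prop where
  one_eq_top : (1 : A) = ⊤

/-- A quantale is coherent if it is algebraic (every element is a join of compact elements),
its top element is compact, and its compact elements are closed under multiplication. -/
class IsCoherent (A : Type*) [CommMonoid A] [CompleteLattice A] : Prop
    extends IsCompactlyGenerated A where
  isCompactElement_top : IsCompactElement (⊤ : A)
  isCompactElement_mul : ∀ c d : A,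
    IsCompactElement c → IsCompactElement d → IsCompactElement (c * d)

section Elements

variable {A : Type*} [CommMonoid A] [CompleteLattice A]

/-- The negation `a^⊥ = a → 0`, that is, the join of all `x` with `a * x ≤ ⊥`. -/
def perp (a : A) : A := rightMulResiduation a ⊥

/-- An element `a` is pure if `a ∨ c^⊥ = 1` for every compact `c ≤ a`. -/
def IsPure (a : A) : Prop := ∀ c : A, IsCompactElement c → c ≤ a → a ⊔ perp c = ⊤

/-- The `m`-prime elements. -/
def IsMPrime (p : A) : Prop := p < ⊤ ∧ ∀ a b : A, a * b ≤ p → a ≤ p ∨ b ≤ p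

end Elements

/-- A quantale is a `PF`-quantale if `c^⊥` is pure for every compact `c`. -/
def IsPF (A : Type*) [CommMonoid A] [CompleteLattice A] : Prop :=
  ∀ c : A, IsCompactElement c → IsPure (perp c)

/-- The set `Spec(A)` of `m`-prime elements, with the order of `A`. -/
abbrev Spec (A : Type*) [CommMonoid A] [CompleteLattice A] : Type _ := {p : A // IsMPrime p}

/-- The set `Min(A)` of minimal `m`-prime elements. -/
def minSpec (A : Type*) [CommMonoid A] [CompleteLattice A] : Set (Spec A) := {p | IsMin p}

/-- `V(a)`, the set of `m`-prime elements above `a`. -/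
def vanishing {A : Type*} [CommMonoid A] [CompleteLattice A] (a : A) : Set (Spec A) :=
  {p | a ≤ p.1}

section Topology

variable (A : Type*) [CommMonoid A] [CompleteLattice A] [IsQuantale A] [IsIntegral A]

/-- The spectral (Zariski) topology on `Spec(A)`: the closed sets are the sets `V(a)`. -/
@[reducible] def zariskiTopology : TopologicalSpace (Spec A) :=
  TopologicalSpace.ofClosed {F | ∃ a : A, F = vanishing a}
    ⟨⊤, by
      ext p
      simp only [vanishing, Set.mem_empty_iff_false, Set.mem_ofPred_eq, false_iff, top_le_iff]
      exact p.2.1.ne⟩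
    (by
      intro S hS
      refine ⟨sSup {a : A | vanishing a ∈ S}, ?_⟩
      ext p
      simp only [vanishing, Set.mem_sInter, Set.mem_ofPred_eq, sSup_le_iff]
      constructor
      · intro h a ha
        exact h _ ha
      · intro h F hF
        obtain ⟨a, rfl⟩ := hS hF
        exact h a hF)
    (by
      rintro _ ⟨a, rfl⟩ _ ⟨b, rfl⟩
      refine ⟨a * b, ?_⟩
      ext p
      simp only [vanishing, Set.mem_union, Set.mem_ofPred_eq]
      constructor
      · have h1 : a * b ≤ a := by
          calc a * b ≤ a * 1 := mul_le_mul_right (IsIntegral.one_eq_top (A := A) ▸ le_top) a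
            _ = a := mul_one a
        have h2 : a * b ≤ b := by
          calc a * b ≤ 1 * b := mul_le_mul_left (IsIntegral.one_eq_top (A := A) ▸ le_top) b
            _ = b := one_mul b
        rintro (h | h)
        · exact h1.trans h
        · exact h2.trans h
      · exact p.2.2 a b)

/-- The flat topology on `Spec(A)`: it has as a basis the complements of the compact open
subsets of `Spec(A)` in the spectral topology. -/
@[reducible] def flatTopology : TopologicalSpace (Spec A) :=
  TopologicalSpace.generateFrom
    {U | IsOpen[zariskiTopology A] Uᶜ ∧ @IsCompact _ (zariskiTopology A) Uᶜ}

end Topology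

end Quantale

/-!
In a `PF`-quantale `(c * d)^⊥ = c^⊥ ⊔ d^⊥` for compact `c` and `d`. This has two consequences:
`(c ^ n)^⊥ ≤ c^⊥`, so that a pure element is the meet of the `m`-primes above it, and for every
`m`-prime `m` the element `O(m)`, the analogue of the kernel of the localization at `m`, is the
least `m`-prime below `m`.

If `a` is pure, then `V(a)` is closed in the flat topology and closed under passing to smaller
`m`-primes, so `a` is the meet of the minimal `m`-primes in `V(a)`. Conversely, let `a` be the meet
of `Min(A) ∩ E` with `E` closed in the flat topology, and let `c ≤ a` be compact. If an `m`-prime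
`m` were above `a ⊔ c^⊥`, then `O(m)` would be minimal and not above `c`, hence outside `E`; a
basic neighbourhood `V(d)` of `O(m)` disjoint from `E` then gives `d^⊥ ≤ a ≤ m`, although
`d ≤ O(m)` means that `d^⊥` is not below `m`.
-/

namespace CoherentQuantale

open Quantale Set TopologicalSpace

section CompactElements

variable {A : Type*} [CompleteLattice A]

theorem isCompactElement_bot : IsCompactElement (⊥ : A) :=
  CompleteLattice.isCompactElement_finsetSup (f := id) ∅ (by simp)

theorem isCompactElement_sup {c d : A} (hc : IsCompactElement c) (hd : IsCompactElement d) :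
    IsCompactElement (c ⊔ d) := by
  classical
  simpa using CompleteLattice.isCompactElement_finsetSup (f := id) {c, d} (by simp [hc, hd])

theorem directedOn_isCompactElement_le (a : A) :
    DirectedOn (· ≤ ·) {c : A | IsCompactElement c ∧ c ≤ a} :=
  fun c hc d hd => ⟨c ⊔ d, ⟨isCompactElement_sup hc.1 hd.1, sup_le hc.2 hd.2⟩,
    le_sup_left, le_sup_right⟩

variable [IsCompactlyGenerated A]

theorem exists_isCompactElement_le_not_le {a b : A} (h : ¬ a ≤ b) :
    ∃ c : A, IsCompactElement c ∧ c ≤ a ∧ ¬ c ≤ b := by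
  by_contra! H
  exact h (le_iff_compact_le_imp.2 H)

theorem exists_isCompactElement_le_sup {k a b : A} (hk : IsCompactElement k) (h : k ≤ a ⊔ b) :
    ∃ d : A, IsCompactElement d ∧ d ≤ b ∧ k ≤ a ⊔ d := by
  have hne : {d : A | IsCompactElement d ∧ d ≤ b}.Nonempty := ⟨⊥, isCompactElement_bot, bot_le⟩
  have hdir : DirectedOn (· ≤ ·) ((a ⊔ ·) '' {d : A | IsCompactElement d ∧ d ≤ b}) :=
    directedOn_image.2 ((directedOn_isCompactElement_le b).mono' fun _ _ _ _ h =>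
      sup_le_sup_left h a)
  have hle : k ≤ sSup ((a ⊔ ·) '' {d : A | IsCompactElement d ∧ d ≤ b}) := by
    rwa [sSup_image, ← sup_biSup hne, ← sSup_eq_iSup, sSup_compact_le_eq]
  obtain ⟨_, ⟨d, ⟨hd, hdb⟩, rfl⟩, hkd⟩ := hk _ _ (hne.image _) hdir (isLUB_sSup _) hle
  exact ⟨d, hd, hdb, hkd⟩

end CompactElements

section Integral

variable {A : Type*} [CommMonoid A] [CompleteLattice A] [Quantale.IsIntegral A]

theorem le_one (a : A) : a ≤ 1 :=
  le_top.trans_eq Quantale.IsIntegral.one_eq_top.symm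

theorem isCompactElement_pow [IsCoherent A] {c : A} (hc : IsCompactElement c) (n : ℕ) :
    IsCompactElement (c ^ n) := by
  induction n with
  | zero =>
    rw [pow_zero, Quantale.IsIntegral.one_eq_top]
    exact IsCoherent.isCompactElement_top
  | succ n ih =>
    rw [pow_succ]
    exact IsCoherent.isCompactElement_mul _ _ ih hc

theorem le_of_pow_le_isMPrime {p c : A} (hp : IsMPrime p) {n : ℕ} (h : c ^ n ≤ p) : c ≤ p := by
  induction n with
  | zero => exact (le_one c).trans (pow_zero c ▸ h)
  | succ n ih => exact (hp.2 _ _ (pow_succ c n ▸ h)).elim ih id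

variable [IsQuantale A]

theorem mul_sup_mul_of_sup_eq_top {a b : A} (h : a ⊔ b = ⊤) (z : A) : z * a ⊔ z * b = z := by
  rw [← mul_sup_distrib, h, ← Quantale.IsIntegral.one_eq_top, mul_one]

theorem sup_mul_sup_le (p x y : A) : (p ⊔ x) * (p ⊔ y) ≤ p ⊔ x * y := by
  rw [mul_sup_distrib, sup_mul_distrib (z := y)]
  exact sup_le
    ((mul_le_of_le_one_left' (le_one _)).trans le_sup_left)
    (sup_le_sup_right (mul_le_of_le_one_right' (le_one _)) _)

end Integral

section Primes

variable {A : Type*} [CommMonoid A] [CompleteLattice A]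

theorem isMPrime_sInf_of_directedOn {C : Set A} (hC : DirectedOn (· ≥ ·) C) (hne : C.Nonempty)
    (hprime : ∀ p ∈ C, IsMPrime p) : IsMPrime (sInf C) := by
  obtain ⟨r, hr⟩ := hne
  refine ⟨(sInf_le hr).trans_lt (hprime r hr).1, fun x y hxy => ?_⟩
  by_contra! h
  simp only [le_sInf_iff, not_forall] at h
  obtain ⟨⟨s, hs, hxs⟩, t, ht, hyt⟩ := h
  obtain ⟨u, hu, hus, hut⟩ := hC s hs t ht
  exact ((hprime u hu).2 x y (hxy.trans (sInf_le hu))).elim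
    (fun hxu => hxs (hxu.trans hus)) fun hyu => hyt (hyu.trans hut)

theorem exists_mem_minSpec_le (p : Spec A) : ∃ q ∈ minSpec A, q ≤ p := by
  obtain ⟨q, hqp, hq, hmin⟩ := zorn_le_nonempty₀ (α := Aᵒᵈ) {x : A | IsMPrime x}
    (fun C hC hchain y hy => ⟨sInf (α := A) C,
      isMPrime_sInf_of_directedOn hchain.directedOn ⟨y, hy⟩ hC,
      fun _ hz => sInf_le (α := A) hz⟩) p.1 p.2
  exact ⟨⟨q, hq⟩, fun r hr => hmin r.2 hr, hqp⟩

theorem exists_isMPrime_forall_not_le [IsQuantale A] [Quantale.IsIntegral A] {S : Submonoid A}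
    (hS : ∀ s ∈ S, IsCompactElement s) {a : A} (ha : ∀ s ∈ S, ¬ s ≤ a) :
    ∃ p : A, IsMPrime p ∧ a ≤ p ∧ ∀ s ∈ S, ¬ s ≤ p := by
  obtain ⟨p, hap, hp, hmax⟩ := zorn_le_nonempty₀ {x : A | ∀ s ∈ S, ¬ s ≤ x}
    (fun C hC hchain y hy => by
      refine ⟨sSup C, fun s hs hle => ?_, fun z hz => le_sSup hz⟩
      obtain ⟨x, hx, hsx⟩ := hS s hs C _ ⟨y, hy⟩ hchain.directedOn (isLUB_sSup C) hle
      exact hC hx s hs hsx) a ha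
  have hmeet : ∀ z : A, ¬ z ≤ p → ∃ s ∈ S, s ≤ p ⊔ z := by
    intro z hz
    by_contra! H
    exact hz (le_sup_right.trans (hmax H le_sup_left))
  refine ⟨p, ⟨lt_top_iff_ne_top.2 ?_, fun x y hxy => ?_⟩, hap, hp⟩
  · rintro rfl
    exact hp 1 S.one_mem le_top
  · by_contra! hn
    obtain ⟨s, hs, hsx⟩ := hmeet x hn.1
    obtain ⟨t, ht, hty⟩ := hmeet y hn.2
    refine hp (s * t) (S.mul_mem hs ht) ?_
    calc s * t ≤ (p ⊔ x) * (p ⊔ y) := mul_le_mul' hsx hty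
      _ ≤ p ⊔ x * y := sup_mul_sup_le p x y
      _ ≤ p := sup_le le_rfl hxy

theorem exists_isMPrime_ge_of_ne_top [IsQuantale A] [Quantale.IsIntegral A]
    (htop : IsCompactElement (⊤ : A)) {a : A} (ha : a ≠ ⊤) : ∃ p : A, IsMPrime p ∧ a ≤ p := by
  obtain ⟨p, hp, hap, -⟩ := exists_isMPrime_forall_not_le (S := ⊥) (a := a)
    (by simpa [Quantale.IsIntegral.one_eq_top] using htop)
    (by simpa [Quantale.IsIntegral.one_eq_top] using ha)
  exact ⟨p, hp, hap⟩

end Primes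

section Vanishing

variable {A : Type*} [CommMonoid A] [CompleteLattice A]

theorem vanishing_bot : vanishing (⊥ : A) = univ :=
  eq_univ_of_forall fun _ => bot_le (α := A)

theorem vanishing_sup (a b : A) : vanishing (a ⊔ b) = vanishing a ∩ vanishing b :=
  Set.ext fun _ => sup_le_iff

theorem vanishing_iSup {ι : Sort*} (b : ι → A) : vanishing (⨆ i, b i) = ⋂ i, vanishing (b i) :=
  Set.ext fun _ => by simp [vanishing]

theorem vanishing_antitone : Antitone (vanishing (A := A)) :=
  fun _ _ h _ hp => h.trans hp

theorem vanishing_subset_vanishing_iff [IsQuantale A] [Quantale.IsIntegral A] [IsCoherent A]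
    {a c : A} (hc : IsCompactElement c) : vanishing a ⊆ vanishing c ↔ ∃ n : ℕ, c ^ n ≤ a := by
  refine ⟨fun h => ?_, fun ⟨n, hn⟩ p hap => le_of_pow_le_isMPrime p.2 (hn.trans hap)⟩
  by_contra! H
  obtain ⟨p, hp, hap, hcp⟩ := exists_isMPrime_forall_not_le (S := Submonoid.powers c) (a := a)
    (by rintro _ ⟨n, rfl⟩; exact isCompactElement_pow hc n)
    (by rintro _ ⟨n, rfl⟩; exact H n)
  exact hcp c (Submonoid.mem_powers c) (h (show (⟨p, hp⟩ : Spec A) ∈ vanishing a from hap))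

end Vanishing

section Zariski

variable {A : Type*} [CommMonoid A] [CompleteLattice A] [IsQuantale A] [Quantale.IsIntegral A]

attribute [local instance] zariskiTopology

theorem isClosed_zariskiTopology_iff {F : Set (Spec A)} :
    IsClosed F ↔ ∃ a : A, F = vanishing a := by
  rw [← isOpen_compl_iff]
  change Fᶜᶜ ∈ {F : Set (Spec A) | ∃ a : A, F = vanishing a} ↔ _
  rw [compl_compl, mem_ofPred_eq]

theorem isOpen_compl_vanishing (a : A) : IsOpen (vanishing a)ᶜ :=
  (isClosed_zariskiTopology_iff.2 ⟨a, rfl⟩).isOpen_compl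

theorem isCompact_compl_vanishing [IsCoherent A] {d : A} (hd : IsCompactElement d) :
    IsCompact (vanishing d)ᶜ := by
  refine isCompact_of_finite_subfamily_closed fun F hF hempty => ?_
  choose b hb using fun i => isClosed_zariskiTopology_iff.1 (hF i)
  obtain rfl : F = fun i => vanishing (b i) := funext hb
  have hdisj (a : A) : (vanishing d)ᶜ ∩ vanishing a = ∅ ↔ ∃ n : ℕ, d ^ n ≤ a := by
    rw [← vanishing_subset_vanishing_iff hd, inter_comm, ← sdiff_eq, sdiff_eq_empty]
  simp only [← vanishing_iSup, hdisj] at hempty ⊢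
  obtain ⟨n, hn⟩ := hempty
  obtain ⟨t, ht⟩ := CompleteLattice.IsCompactElement.exists_finset_of_le_iSup A
    (isCompactElement_pow hd n) b hn
  exact ⟨t, n, ht⟩

theorem exists_isCompactElement_eq_vanishing [IsCompactlyGenerated A] {U : Set (Spec A)}
    (hopen : IsOpen Uᶜ) (hcompact : IsCompact Uᶜ) :
    ∃ d : A, IsCompactElement d ∧ U = vanishing d := by
  obtain ⟨b, rfl⟩ := isClosed_zariskiTopology_iff.1 (isOpen_compl_iff.1 hopen)
  have hcover : (vanishing b)ᶜ ⊆
      ⋃ c : {c : A | IsCompactElement c ∧ c ≤ b}, (vanishing c.1)ᶜ := by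
    rw [← compl_iInter, ← vanishing_iSup, ← sSup_eq_iSup', sSup_compact_le_eq]
  have : Nonempty {c : A | IsCompactElement c ∧ c ≤ b} := ⟨⊥, isCompactElement_bot, bot_le⟩
  obtain ⟨⟨d, hd, hdb⟩, hsub⟩ := hcompact.elim_directed_cover
    (fun c : {c : A | IsCompactElement c ∧ c ≤ b} => (vanishing c.1)ᶜ)
    (fun c => isOpen_compl_vanishing c.1) hcover
    ((directedOn_isCompactElement_le b).directed_val.mono_comp _ (g := fun c => (vanishing c)ᶜ)
      fun _ _ h => compl_subset_compl.2 (vanishing_antitone h))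
  exact ⟨d, hd, (vanishing_antitone hdb).antisymm (compl_subset_compl.1 hsub)⟩

end Zariski

section Flat

variable (A : Type*) [CommMonoid A] [CompleteLattice A] [IsQuantale A] [Quantale.IsIntegral A]
  [IsCoherent A]

theorem flatTopology_eq_generateFrom :
    flatTopology A = generateFrom (vanishing '' {d : A | IsCompactElement d}) := by
  refine congrArg generateFrom (Set.ext fun U => ?_)
  constructor
  · rintro ⟨hopen, hcompact⟩
    obtain ⟨d, hd, rfl⟩ := exists_isCompactElement_eq_vanishing hopen hcompact
    exact ⟨d, hd, rfl⟩
  · rintro ⟨d, hd, rfl⟩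
    exact ⟨isOpen_compl_vanishing d, isCompact_compl_vanishing hd⟩

theorem isTopologicalBasis_flatTopology :
    @IsTopologicalBasis _ (flatTopology A) (vanishing '' {d : A | IsCompactElement d}) := by
  refine @isTopologicalBasis_of_subbasis_of_finiteInter _ (flatTopology A) _
    (flatTopology_eq_generateFrom A) ⟨⟨⊥, isCompactElement_bot, vanishing_bot⟩, ?_⟩
  rintro _ ⟨d, hd, rfl⟩ _ ⟨e, he, rfl⟩
  exact ⟨d ⊔ e, isCompactElement_sup hd he, vanishing_sup d e⟩

end Flat

section Perp

variable {A : Type*} [CommMonoid A] [CompleteLattice A] [IsQuantale A]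

theorem le_perp_iff {a x : A} : x ≤ perp a ↔ a * x = ⊥ :=
  rightMulResiduation_le_iff_mul_le.trans le_bot_iff

theorem le_perp_comm {a x : A} : x ≤ perp a ↔ a ≤ perp x := by
  rw [le_perp_iff, le_perp_iff, mul_comm]

theorem mul_perp (a : A) : a * perp a = ⊥ :=
  le_perp_iff.1 le_rfl

theorem perp_one : perp (1 : A) = ⊥ := by
  rw [← one_mul (perp 1), mul_perp]

theorem perp_le_perp_mul_right (a b : A) : perp a ≤ perp (a * b) := by
  rw [le_perp_iff, mul_right_comm, mul_perp, bot_mul]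

theorem perp_le_perp_mul_left (a b : A) : perp b ≤ perp (a * b) :=
  mul_comm b a ▸ perp_le_perp_mul_right b a

theorem perp_le_of_not_le {p c : A} (hp : IsMPrime p) (hc : ¬ c ≤ p) : perp c ≤ p :=
  (hp.2 c (perp c) ((mul_perp c).trans_le bot_le)).resolve_left hc

theorem le_of_sup_perp_eq_top [Quantale.IsIntegral A] {a c : A} (h : a ⊔ perp c = ⊤) :
    c ≤ a := by
  calc c = c * a ⊔ c * perp c := (mul_sup_mul_of_sup_eq_top h c).symm
    _ = c * a := by rw [mul_perp, sup_bot_eq]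
    _ ≤ a := mul_le_of_le_one_left' (le_one c)

end Perp

section PF

variable {A : Type*} [CommMonoid A] [CompleteLattice A] [IsQuantale A] [Quantale.IsIntegral A]
  [IsCoherent A]

theorem perp_mul_of_isPF (hA : IsPF A) {c d : A} (hc : IsCompactElement c)
    (hd : IsCompactElement d) : perp (c * d) = perp c ⊔ perp d := by
  refine le_antisymm (le_iff_compact_le_imp.2 fun z hz hzcd => ?_)
    (sup_le (perp_le_perp_mul_right c d) (perp_le_perp_mul_left c d))
  have hdz : d * z ≤ perp c := le_perp_iff.2 (by rw [← mul_assoc, le_perp_iff.1 hzcd])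
  have htop : perp c ⊔ perp (d * z) = ⊤ :=
    hA c hc _ (IsCoherent.isCompactElement_mul d z hd hz) hdz
  have hzd : z * perp (d * z) ≤ perp d := le_perp_iff.2 (by rw [← mul_assoc, mul_perp])
  calc z = z * perp c ⊔ z * perp (d * z) := (mul_sup_mul_of_sup_eq_top htop z).symm
    _ ≤ perp c ⊔ perp d := sup_le_sup (mul_le_of_le_one_left' (le_one z)) hzd

theorem perp_pow_le_of_isPF (hA : IsPF A) {c : A} (hc : IsCompactElement c) (n : ℕ) :
    perp (c ^ n) ≤ perp c := by
  induction n with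
  | zero => exact pow_zero c ▸ perp_one.trans_le bot_le
  | succ n ih =>
    rw [pow_succ, perp_mul_of_isPF hA (isCompactElement_pow hc n) hc]
    exact sup_le ih le_rfl

theorem le_of_pow_le_isPure (hA : IsPF A) {a c : A} (ha : IsPure a) (hc : IsCompactElement c)
    {n : ℕ} (h : c ^ n ≤ a) : c ≤ a := by
  refine le_of_sup_perp_eq_top (top_le_iff.1 ?_)
  calc ⊤ = a ⊔ perp (c ^ n) := (ha _ (isCompactElement_pow hc n) h).symm
    _ ≤ a ⊔ perp c := sup_le_sup_left (perp_pow_le_of_isPF hA hc n) a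

end PF

section LocalKernel

variable {A : Type*} [CommMonoid A] [CompleteLattice A]

/-- The element `O(m)`, the analogue of the kernel of the localization of a commutative ring at a
prime ideal `m`: the join of all `x` annihilated by some `y` that is not below `m`. In an algebraic
quantale, letting only compact `y` enter, as is customary, gives the same join. -/
def localKernel (m : A) : A := sSup (perp '' {y | ¬ y ≤ m})

variable [IsQuantale A]

theorem localKernel_le {m p : A} (hp : IsMPrime p) (hpm : p ≤ m) : localKernel m ≤ p :=
  sSup_le <| forall_mem_image.2 fun _ hy => perp_le_of_not_le hp fun hyp => hy (hyp.trans hpm)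

theorem le_localKernel_iff {m c : A} (hm : IsMPrime m) (hc : IsCompactElement c) :
    c ≤ localKernel m ↔ ¬ perp c ≤ m := by
  refine ⟨fun h => ?_, fun h => (le_perp_comm.1 le_rfl).trans (le_sSup (mem_image_of_mem _ h))⟩
  have hdir : DirectedOn (· ≤ ·) (perp '' {y | ¬ y ≤ m}) := by
    rintro _ ⟨y, hy, rfl⟩ _ ⟨z, hz, rfl⟩
    exact ⟨perp (y * z), mem_image_of_mem _ fun h => (hm.2 y z h).elim hy hz,
      perp_le_perp_mul_right y z, perp_le_perp_mul_left y z⟩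
  obtain ⟨_, ⟨y, hy, rfl⟩, hcy⟩ :=
    hc _ _ (Nonempty.image _ ⟨⊤, hm.1.not_ge⟩) hdir (isLUB_sSup _) h
  exact fun hcm => hy ((le_perp_comm.1 hcy).trans hcm)

variable [Quantale.IsIntegral A] [IsCoherent A]

theorem isMPrime_localKernel (hA : IsPF A) {m : A} (hm : IsMPrime m) :
    IsMPrime (localKernel m) := by
  refine ⟨(localKernel_le hm le_rfl).trans_lt hm.1, fun a b hab => ?_⟩
  by_contra! hn
  obtain ⟨c, hc, hca, hcm⟩ := exists_isCompactElement_le_not_le hn.1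
  obtain ⟨d, hd, hdb, hdm⟩ := exists_isCompactElement_le_not_le hn.2
  have hcd := IsCoherent.isCompactElement_mul c d hc hd
  rw [le_localKernel_iff hm hc, not_not] at hcm
  rw [le_localKernel_iff hm hd, not_not] at hdm
  refine (le_localKernel_iff hm hcd).1 ((mul_le_mul' hca hdb).trans hab) ?_
  rw [perp_mul_of_isPF hA hc hd]
  exact sup_le hcm hdm

theorem localKernel_mem_minSpec (hA : IsPF A) {m : A} (hm : IsMPrime m) :
    (⟨localKernel m, isMPrime_localKernel hA hm⟩ : Spec A) ∈ minSpec A :=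
  fun q hq => localKernel_le q.2 (le_trans (b := localKernel m) hq (localKernel_le hm le_rfl))

end LocalKernel

section Pure

variable {A : Type*} [CommMonoid A] [CompleteLattice A] [IsQuantale A]

theorem le_isMPrime_of_isPure [IsCompactlyGenerated A] {a p q : A} (ha : IsPure a) (hp : p ≠ ⊤)
    (hq : IsMPrime q) (hqp : q ≤ p) (hap : a ≤ p) : a ≤ q := by
  refine le_iff_compact_le_imp.2 fun c hc hca => ?_
  by_contra hcq
  have hcp : perp c ≤ p := (perp_le_of_not_le hq hcq).trans hqp
  exact hp (top_le_iff.1 ((ha c hc hca).ge.trans (sup_le hap hcp)))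

variable [Quantale.IsIntegral A] [IsCoherent A]

theorem eq_sInf_minSpec_inter_vanishing_of_isPure (hA : IsPF A) {a : A} (ha : IsPure a) :
    a = sInf (Subtype.val '' (minSpec A ∩ vanishing a)) := by
  refine le_antisymm (le_sInf ?_) (le_iff_compact_le_imp.2 fun c hc hle => ?_)
  · rintro _ ⟨p, ⟨-, hap⟩, rfl⟩
    exact hap
  · have hsub : vanishing a ⊆ vanishing c := by
      intro p hap
      obtain ⟨q, hqmin, hqp⟩ := exists_mem_minSpec_le p
      have haq : a ≤ q.1 := le_isMPrime_of_isPure ha p.2.1.ne q.2 hqp hap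
      exact (hle.trans (sInf_le ⟨q, ⟨hqmin, haq⟩, rfl⟩)).trans hqp
    obtain ⟨n, hn⟩ := (vanishing_subset_vanishing_iff hc).1 hsub
    exact le_of_pow_le_isPure hA ha hc hn

theorem isClosed_vanishing_of_isPure {a : A} (ha : IsPure a) :
    IsClosed[flatTopology A] (vanishing a) := by
  let _ := flatTopology A
  rw [← isOpen_compl_iff, (isTopologicalBasis_flatTopology A).isOpen_iff]
  intro p hap
  obtain ⟨c, hc, hca, hcp⟩ := exists_isCompactElement_le_not_le hap
  obtain ⟨d, hd, hdc, htop⟩ :=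
    exists_isCompactElement_le_sup IsCoherent.isCompactElement_top (ha c hc hca).ge
  refine ⟨vanishing d, mem_image_of_mem _ hd, hdc.trans (perp_le_of_not_le p.2 hcp), ?_⟩
  exact fun q hdq haq => q.2.1.not_ge (htop.trans (sup_le haq hdq))

theorem isPure_sInf_minSpec_inter (hA : IsPF A) {E : Set (Spec A)}
    (hE : IsClosed[flatTopology A] E) : IsPure (sInf (Subtype.val '' (minSpec A ∩ E))) := by
  let _ := flatTopology A
  intro c hc hca
  by_contra hne
  obtain ⟨m, hm, hle⟩ := exists_isMPrime_ge_of_ne_top IsCoherent.isCompactElement_top hne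
  obtain ⟨ham, hcm⟩ := sup_le_iff.1 hle
  let q : Spec A := ⟨localKernel m, isMPrime_localKernel hA hm⟩
  have hqE : q ∈ Eᶜ := fun hq => (le_localKernel_iff hm hc).1
    (hca.trans (sInf_le ⟨q, ⟨localKernel_mem_minSpec hA hm, hq⟩, rfl⟩)) hcm
  obtain ⟨_, ⟨d, hd, rfl⟩, hdq, hdE⟩ :=
    (isTopologicalBasis_flatTopology A).exists_subset_of_mem_open hqE hE.isOpen_compl
  refine (le_localKernel_iff hm hd).1 hdq (le_trans (le_sInf ?_) ham)
  rintro _ ⟨p, ⟨-, hpE⟩, rfl⟩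
  exact perp_le_of_not_le p.2 fun hdp => hdE hdp hpE

end Pure

end CoherentQuantale

theorem theorem6p10 (A : Type*) [CommMonoid A] [CompleteLattice A] [IsQuantale A]
    [Quantale.IsIntegral A] [Quantale.IsCoherent A] (hA : Quantale.IsPF A) (a : A) :
    Quantale.IsPure a ↔
      ∃ E : Set (Quantale.Spec A), IsClosed[Quantale.flatTopology A] E ∧
        a = sInf (Subtype.val '' (Quantale.minSpec A ∩ E)) := by
  constructor
  · intro ha
    exact ⟨Quantale.vanishing a, CoherentQuantale.isClosed_vanishing_of_isPure ha,
      CoherentQuantale.eq_sInf_minSpec_inter_vanishing_of_isPure hA ha⟩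
  · rintro ⟨E, hE, rfl⟩
    exact CoherentQuantale.isPure_sInf_minSpec_inter hA hE
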